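/- For a nonempty integer partition $\pi$ let $s(\pi)$ denote its smallest part. Let $spt(n)$ be Andrews' smallest parts function, i.e. the total number of occurrences of the smallest part, $\sum_{\pi} \#\{\text{parts of } \pi \text{ equal to } s(\pi)\}$, summed over all partitions $\pi$ of $n$. Let $spt_o^{+}(n)$ be the same sum restricted to those partitions $\pi$ of $n$ in which no odd part greater than $2s(\pi)$ occurs. (The empty partition contributes $0$ to both sums.) Then for every integer $n\ge 0$, $$spt_o^{+}(2n)\equiv spt(n)\pmod 2.$$ -/

import Mathlib

/-- The smallest part `s(π)` of a partition `π` (with value `0` for the empty partition). -/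
noncomputable def smallestPart {n : ℕ} (π : n.Partition) : ℕ :=
  sInf {i : ℕ | i ∈ π.parts}

/-- The number of occurrences of the smallest part in a partition
(this is `0` for the empty partition, which has no parts). -/
noncomputable def smallestPartCount {n : ℕ} (π : n.Partition) : ℕ :=
  π.parts.count (smallestPart π)

/-- Andrews' function `spt(n)`: the total number of smallest parts among all partitions of `n`. -/
noncomputable def spt (n : ℕ) : ℕ :=
  ∑ π : n.Partition, smallestPartCount π

/-- Odd parts greater than twice the smallest part do not occur in `π`. -/
def NoLargeOddParts {n : ℕ} (π : n.Partition) : Prop :=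
  ∀ i ∈ π.parts, Odd i → ¬ 2 * smallestPart π < i

open Classical in
/-- The function `spt_o^+(n)`: the total number of smallest parts among the partitions `π` of `n`
in which odd parts greater than twice the smallest part of `π` do not occur. -/
noncomputable def sptOPlus (n : ℕ) : ℕ :=
  ∑ π : n.Partition with NoLargeOddParts π, smallestPartCount π

/-! Write (q)_n for `qPoch q n`. Sorted by smallest part s, both counts have generating functions
that are sums over s. Multiplied by (q^2;q^2)_∞, the one for `sptOPlus` becomes ∑ q^s (q)_s /
((1-q^s)^2 (q;q^2)_s), and the one for `spt`, with q replaced by q^2, becomes ∑ q^(2s) (q^2;q^2)_s /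
(1-q^(2s))^2.

Each is the left side of a twice-differentiated Bailey lemma (`dvd_sum_baileyPair`): the first for a
pair in base q with α supported on even indices, the second for the pentagonal pair in base q^2. The
two α-sums coincide term by term, so the difference of the two series is ∑ q^k/(1-q^k)^2 - ∑
q^(2k)/(1-q^(2k))^2, the sum of q^k/(1-q^k)^2 over odd k (`dvd_sum_sub_sum`).

Modulo 2, (1-q^k)^2 = 1-q^(2k), so this has only odd exponents. Dividing by the even series
(q^2;q^2)_∞ keeps it so, and comparing coefficients of q^(2n) finishes. All identities are truncated
modulo q^(N+1), with N = 2n at the end, so no infinite q-products are needed. -/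

section QSeries

open Finset

variable {A : Type*} [CommRing A] (q : A)

/-! ### q-Pochhammer symbols and the Bailey kernel -/

/-- The inverse of `1 - q ^ k`. -/
noncomputable def invOneSubQPow (k : ℕ) : A := Ring.inverse (1 - q ^ k)

/-- The `q`-Pochhammer symbol `(q; q)_n`. -/
def qPoch (n : ℕ) : A := ∏ i ∈ range n, (1 - q ^ (i + 1))

/-- The inverse of the `q`-Pochhammer symbol `(q; q)_n`. -/
noncomputable def invQPoch (n : ℕ) : A := ∏ i ∈ range n, invOneSubQPow q (i + 1)

/-- The Bailey kernel `1 / ((q)_{n-r} (q)_{n+r})`, which vanishes for `n < r`. -/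
noncomputable def baileyKernel (n r : ℕ) : A :=
  if r ≤ n then invQPoch q (n - r) * invQPoch q (n + r) else 0

/-- The pentagonal numbers `r (3 r - 1) / 2`. -/
def pentExp (r : ℕ) : ℕ := ∑ i ∈ range r, (3 * i + 1)

lemma pentExp_succ (r : ℕ) : pentExp (r + 1) = pentExp r + (3 * r + 1) :=
  sum_range_succ _ _

lemma qPoch_succ (n : ℕ) : qPoch q (n + 1) = qPoch q n * (1 - q ^ (n + 1)) :=
  prod_range_succ _ _

lemma invQPoch_succ (n : ℕ) : invQPoch q (n + 1) = invQPoch q n * invOneSubQPow q (n + 1) :=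
  prod_range_succ _ _

variable {q}

lemma invOneSubQPow_mul (hq : ∀ k : ℕ, 0 < k → IsUnit (1 - q ^ k)) {k : ℕ} (hk : 0 < k) :
    invOneSubQPow q k * (1 - q ^ k) = 1 :=
  Ring.inverse_mul_cancel _ (hq k hk)

lemma invQPoch_succ_mul (hq : ∀ k : ℕ, 0 < k → IsUnit (1 - q ^ k)) (n : ℕ) :
    invQPoch q (n + 1) * (1 - q ^ (n + 1)) = invQPoch q n := by
  rw [invQPoch_succ, mul_assoc, invOneSubQPow_mul hq (Nat.add_one_pos n), mul_one]

lemma qPoch_mul_invQPoch (hq : ∀ k : ℕ, 0 < k → IsUnit (1 - q ^ k)) (n : ℕ) :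
    qPoch q n * invQPoch q n = 1 := by
  induction n with
  | zero => simp [qPoch, invQPoch]
  | succ n ih =>
    rw [qPoch_succ, invQPoch_succ]
    linear_combination (1 - q ^ (n + 1)) * invOneSubQPow q (n + 1) * ih +
      invOneSubQPow_mul hq (Nat.add_one_pos n)

lemma baileyKernel_of_lt {n r : ℕ} (h : n < r) : baileyKernel q n r = 0 := if_neg (by omega)

lemma baileyKernel_add (r k : ℕ) :
    baileyKernel q (r + k) r = invQPoch q k * invQPoch q (2 * r + k) := by
  rw [baileyKernel, if_pos (by omega), Nat.add_sub_cancel_left]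
  congr 2
  omega

lemma baileyKernel_succ_left (hq : ∀ k : ℕ, 0 < k → IsUnit (1 - q ^ k)) (n r : ℕ) :
    baileyKernel q n r =
      (1 - q ^ (n + 1 - r)) * (1 - q ^ (n + 1 + r)) * baileyKernel q (n + 1) r := by
  rcases lt_trichotomy (n + 1) r with h | rfl | h
  · simp [baileyKernel_of_lt h, baileyKernel_of_lt (show n < r by omega)]
  · simp [baileyKernel_of_lt (show n < n + 1 by omega)]
  · obtain ⟨k, rfl⟩ : ∃ k, n = r + k := ⟨n - r, by omega⟩
    rw [baileyKernel_add, add_assoc r k 1, baileyKernel_add, Nat.add_sub_cancel_left,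
      ← invQPoch_succ_mul hq k, ← invQPoch_succ_mul hq (2 * r + k),
      show r + (k + 1) + r = 2 * r + k + 1 by ring, ← add_assoc (2 * r)]
    ring

lemma baileyKernel_succ_right (hq : ∀ k : ℕ, 0 < k → IsUnit (1 - q ^ k)) (n r : ℕ) :
    (1 - q ^ (n + r + 1)) * baileyKernel q n (r + 1) =
      (1 - q ^ (n - r)) * baileyKernel q n r := by
  rcases lt_trichotomy n r with h | rfl | h
  · simp [baileyKernel_of_lt h, baileyKernel_of_lt (show n < r + 1 by omega)]
  · simp [baileyKernel_of_lt (show n < n + 1 by omega)]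
  · obtain ⟨k, rfl⟩ : ∃ k, n = r + 1 + k := ⟨n - (r + 1), by omega⟩
    rw [baileyKernel_add, add_assoc r 1 k, baileyKernel_add, Nat.add_sub_cancel_left,
      show 2 * (r + 1) + k = 2 * r + (1 + k) + 1 by ring, add_comm 1 k,
      ← invQPoch_succ_mul hq k, ← invQPoch_succ_mul hq (2 * r + (k + 1)),
      show r + (k + 1) + r + 1 = 2 * r + (k + 1) + 1 by ring]
    ring

/-! ### Bailey's lemma, differentiated twice -/

/-- A terminating sum, the indefinite form of the `q`-Gauss sum with argument `q`. -/
lemma sum_baileyKernel (hq : ∀ k : ℕ, 0 < k → IsUnit (1 - q ^ k)) {r : ℕ} (hr : 0 < r) (N : ℕ) :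
    ∑ n ∈ Icc 1 N, q ^ n * invOneSubQPow q n ^ 2 * qPoch q n ^ 2 * baileyKernel q n r =
      q ^ r * invOneSubQPow q r ^ 2 * (qPoch q N ^ 2 * baileyKernel q N r) := by
  induction N with
  | zero => simp [baileyKernel_of_lt hr]
  | succ N ih =>
    rw [sum_Icc_succ_top (by omega), ih, baileyKernel_succ_left hq N r, qPoch_succ]
    rcases lt_or_ge (N + 1) r with h | h
    · simp [baileyKernel_of_lt h]
    · obtain ⟨k, hk⟩ : ∃ k, N + 1 = r + k := ⟨N + 1 - r, by omega⟩
      have h1 := invOneSubQPow_mul hq hr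
      have h2 := invOneSubQPow_mul hq (Nat.add_one_pos N)
      rw [hk] at h2 ⊢
      rw [Nat.add_sub_cancel_left]
      simp only [pow_add] at h2 ⊢
      generalize baileyKernel q (r + k) r = w at *
      generalize invOneSubQPow q r = a at *
      generalize invOneSubQPow q (r + k) = b at *
      generalize q ^ r = x at *
      generalize q ^ k = y at *
      generalize qPoch q N = p at *
      -- The sum telescopes because (1-xy)^2 - (1-y)(1-x^2 y) = y(1-x)^2, where x = q^r and y = q^k.
      linear_combination p ^ 2 * w * x * y * ((b * (1 - x * y) + 1) * h2 - (a * (1 - x) + 1) * h1)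

lemma dvd_invOneSubQPow_sub_one (hq : ∀ k : ℕ, 0 < k → IsUnit (1 - q ^ k)) {k : ℕ} (hk : 0 < k) :
    q ^ k ∣ invOneSubQPow q k - 1 :=
  ⟨invOneSubQPow q k, by linear_combination invOneSubQPow_mul hq hk⟩

lemma dvd_qPoch_mul_invQPoch_add (hq : ∀ k : ℕ, 0 < k → IsUnit (1 - q ^ k)) (n r : ℕ) :
    q ^ (n + 1) ∣ qPoch q n * invQPoch q (n + r) - 1 := by
  induction r with
  | zero => simp [qPoch_mul_invQPoch hq]
  | succ r ih =>
    rw [← add_assoc, invQPoch_succ]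
    have h := (pow_dvd_pow q (show n + 1 ≤ n + r + 1 by omega)).trans
      (dvd_invOneSubQPow_sub_one hq (Nat.add_one_pos (n + r)))
    convert (ih.mul_right (invOneSubQPow q (n + r + 1))).add h using 1
    ring

lemma dvd_qPoch_add_mul_invQPoch (hq : ∀ k : ℕ, 0 < k → IsUnit (1 - q ^ k)) (n r : ℕ) :
    q ^ (n + 1) ∣ qPoch q (n + r) * invQPoch q n - 1 := by
  induction r with
  | zero => simp [qPoch_mul_invQPoch hq]
  | succ r ih =>
    rw [← add_assoc, qPoch_succ]
    have h := pow_dvd_pow q (show n + 1 ≤ n + r + 1 by omega)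
    convert (ih.mul_right (1 - q ^ (n + r + 1))).sub h using 1
    ring

/-- The quotient (q)_N/(q)_(N-r) is 1 only modulo q^(N-r+1); the factor q^r supplies the missing
precision. -/
lemma dvd_qPoch_sq_mul_baileyKernel (hq : ∀ k : ℕ, 0 < k → IsUnit (1 - q ^ k)) (N r : ℕ) :
    q ^ (N + 1) ∣ q ^ r * (qPoch q N ^ 2 * baileyKernel q N r) - q ^ r := by
  rcases lt_or_ge N r with h | h
  · rw [baileyKernel_of_lt h, mul_zero, mul_zero, zero_sub, dvd_neg]
    exact pow_dvd_pow q h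
  · obtain ⟨k, rfl⟩ : ∃ k, N = k + r := ⟨N - r, by omega⟩
    have h1 := dvd_qPoch_mul_invQPoch_add hq (k + r) r
    have h2 := mul_dvd_mul_left (q ^ r) (dvd_qPoch_add_mul_invQPoch hq k r)
    rw [← pow_add, show r + (k + 1) = k + r + 1 by ring] at h2
    rw [add_comm k r, baileyKernel_add, show 2 * r + k = k + r + r by ring, add_comm r k]
    convert (h1.mul_left (q ^ r * (qPoch q (k + r) * invQPoch q k))).add h2 using 1
    ring

/-- The second derivative at `1` of Bailey's lemma, for a Bailey pair relative to `1` whose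
`α`-sequence is supported on the multiples of `d`, modulo `q ^ (N + 1)`. -/
lemma dvd_sum_baileyPair (hq : ∀ k : ℕ, 0 < k → IsUnit (1 - q ^ k)) {d : ℕ} (hd : 0 < d)
    (α β : ℕ → A) (N : ℕ)
    (hβ : ∀ n ≤ N, β n = baileyKernel q n 0 + ∑ r ∈ Icc 1 N, α r * baileyKernel q n (d * r)) :
    q ^ (N + 1) ∣ ∑ n ∈ Icc 1 N, q ^ n * invOneSubQPow q n ^ 2 * qPoch q n ^ 2 * β n -
      (∑ n ∈ Icc 1 N, q ^ n * invOneSubQPow q n ^ 2 +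
        ∑ r ∈ Icc 1 N, q ^ (d * r) * invOneSubQPow q (d * r) ^ 2 * α r) := by
  have h1 : ∑ n ∈ Icc 1 N, q ^ n * invOneSubQPow q n ^ 2 * qPoch q n ^ 2 * β n =
      ∑ n ∈ Icc 1 N, q ^ n * invOneSubQPow q n ^ 2 +
        ∑ r ∈ Icc 1 N, α r * (q ^ (d * r) * invOneSubQPow q (d * r) ^ 2 *
          (qPoch q N ^ 2 * baileyKernel q N (d * r))) := by
    have : ∀ r ∈ Icc 1 N, α r * (q ^ (d * r) * invOneSubQPow q (d * r) ^ 2 *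
          (qPoch q N ^ 2 * baileyKernel q N (d * r))) =
        ∑ n ∈ Icc 1 N, α r * (q ^ n * invOneSubQPow q n ^ 2 * qPoch q n ^ 2 *
          baileyKernel q n (d * r)) := fun r hr ↦ by
      rw [← sum_baileyKernel hq (Nat.mul_pos hd (mem_Icc.1 hr).1), mul_sum]
    rw [sum_congr rfl this, sum_comm, ← sum_add_distrib]
    refine sum_congr rfl fun n hn ↦ ?_
    rw [hβ n (mem_Icc.1 hn).2, mul_add, mul_sum]
    congr 1
    · have h0 : baileyKernel q n 0 = invQPoch q n * invQPoch q n := by simp [baileyKernel]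
      rw [h0]
      linear_combination q ^ n * invOneSubQPow q n ^ 2 * (qPoch q n * invQPoch q n + 1) *
        qPoch_mul_invQPoch hq n
    · exact sum_congr rfl fun r _ ↦ by ring
  rw [h1, add_sub_add_left_eq_sub, ← sum_sub_distrib]
  refine dvd_sum fun r _ ↦ ?_
  convert (dvd_qPoch_sq_mul_baileyKernel hq N (d * r)).mul_left
    (α r * invOneSubQPow q (d * r) ^ 2) using 1
  ring

/-! ### The two pentagonal Bailey pairs -/

/-- Partial sums in the recurrence for the Bailey pair with `β n = 1 / (q)_n`. -/
lemma sum_pentagonal_recurrence (hq : ∀ k : ℕ, 0 < k → IsUnit (1 - q ^ k)) (n R : ℕ) :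
    (1 - q ^ (n + 1)) * (baileyKernel q (n + 1) 0 + ∑ r ∈ Icc 1 R,
        (-1) ^ r * q ^ pentExp r * (1 + q ^ r) * baileyKernel q (n + 1) r) -
      (baileyKernel q n 0 + ∑ r ∈ Icc 1 R,
        (-1) ^ r * q ^ pentExp r * (1 + q ^ r) * baileyKernel q n r) =
      (-1) ^ R * q ^ pentExp R * q ^ (n + 1 + 2 * R) *
        ((1 - q ^ (n + 1 + R + 1)) * baileyKernel q (n + 1) (R + 1)) := by
  induction R with
  | zero =>
    rw [baileyKernel_succ_right hq (n + 1) 0, baileyKernel_succ_left hq n 0]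
    simp [pentExp]
    ring
  | succ R ih =>
    rw [sum_Icc_succ_top (by omega), sum_Icc_succ_top (by omega),
      baileyKernel_succ_right hq (n + 1) (R + 1), pentExp_succ]
    have h := baileyKernel_succ_left hq n (R + 1)
    rcases lt_or_ge (n + 1) (R + 1) with hn | hn
    · rw [baileyKernel_of_lt hn] at ih h ⊢
      rw [h]
      linear_combination ih
    · obtain ⟨k, hk⟩ : ∃ k, n + 1 = R + 1 + k := ⟨n - R, by omega⟩
      rw [hk] at ih h ⊢
      rw [Nat.add_sub_cancel_left] at h ⊢
      rw [h]
      linear_combination ih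

/-- Once the summation range reaches n+1, the boundary term of the recurrence contains a vanishing
kernel, so both sides obey the same first-order recurrence in n. -/
lemma baileyPair_pentagonal (hq : ∀ k : ℕ, 0 < k → IsUnit (1 - q ^ k)) (n : ℕ) :
    ∀ N, n ≤ N → invQPoch q n = baileyKernel q n 0 + ∑ r ∈ Icc 1 N,
      (-1) ^ r * q ^ pentExp r * (1 + q ^ r) * baileyKernel q n r := by
  induction n with
  | zero =>
    intro N _
    rw [sum_eq_zero fun r hr ↦ by rw [baileyKernel_of_lt (mem_Icc.1 hr).1, mul_zero]]
    simp [baileyKernel, invQPoch]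
  | succ n ih =>
    intro N hN
    have h := sum_pentagonal_recurrence hq n N
    rw [← ih N (by omega), baileyKernel_of_lt (show n + 1 < N + 1 by omega), mul_zero, mul_zero,
      ← invQPoch_succ_mul hq] at h
    refine (hq (n + 1) (by omega)).mul_right_cancel ?_
    linear_combination -h

/-- Partial sums in the recurrence for the Bailey pair with `β n = 1 / ((q)_n (q; q^2)_n)`. -/
lemma sum_double_pentagonal_recurrence (hq : ∀ k : ℕ, 0 < k → IsUnit (1 - q ^ k)) (n R : ℕ) :
    (1 - q ^ (n + 1)) * (1 - q ^ (2 * n + 1)) * (baileyKernel q (n + 1) 0 + ∑ r ∈ Icc 1 R,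
        (-1) ^ r * (q ^ 2) ^ pentExp r * (1 + (q ^ 2) ^ r) * baileyKernel q (n + 1) (2 * r)) -
      (baileyKernel q n 0 + ∑ r ∈ Icc 1 R,
        (-1) ^ r * (q ^ 2) ^ pentExp r * (1 + (q ^ 2) ^ r) * baileyKernel q n (2 * r)) =
      (-1) ^ R * (q ^ 2) ^ pentExp R * q ^ (n + 1 + 4 * R) *
        ((1 - q ^ (n + 1 + 2 * R + 1)) * ((1 - q ^ (n + 1 + (2 * R + 1) + 1)) *
          baileyKernel q (n + 1) (2 * R + 1 + 1))) := by
  -- Lowers the kernel index by two, since α lives on even indices; this turns the boundary term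
  -- into a multiple of the next summand's kernel.
  have hstep (R : ℕ) : (1 - q ^ (n + 1 + 2 * R + 1)) * ((1 - q ^ (n + 1 + (2 * R + 1) + 1)) *
      baileyKernel q (n + 1) (2 * R + 1 + 1)) =
      (1 - q ^ (n - 2 * R)) * (1 - q ^ (n + 1 - 2 * R)) * baileyKernel q (n + 1) (2 * R) := by
    rw [baileyKernel_succ_right hq (n + 1) (2 * R + 1), Nat.add_sub_add_right]
    linear_combination (1 - q ^ (n - 2 * R)) * baileyKernel_succ_right hq (n + 1) (2 * R)
  induction R with
  | zero =>
    rw [hstep 0, baileyKernel_succ_left hq n 0]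
    simp [pentExp]
    ring
  | succ R ih =>
    rw [sum_Icc_succ_top (by omega), sum_Icc_succ_top (by omega), hstep, pentExp_succ,
      show 2 * (R + 1) = 2 * R + 1 + 1 by ring]
    have h := baileyKernel_succ_left hq n (2 * R + 1 + 1)
    -- The middle case is separate because n - (2R+2) truncates to 0 there; the factor with exponent
    -- n+1-(2R+2) = 0 vanishes anyway.
    rcases lt_trichotomy (n + 1) (2 * R + 1 + 1) with hn | hn | hn
    · rw [baileyKernel_of_lt hn] at ih h ⊢
      rw [h]
      linear_combination ih
    · obtain rfl : n = 2 * R + 1 := by omega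
      rw [Nat.sub_self] at h ⊢
      rw [h]
      linear_combination ih
    · obtain ⟨k, rfl⟩ : ∃ k, n = 2 * R + 1 + 1 + k := ⟨n - (2 * R + 1 + 1), by omega⟩
      have hk : 2 * R + 1 + 1 + k + 1 - (2 * R + 1 + 1) = k + 1 := by omega
      rw [hk] at h ⊢
      rw [Nat.add_sub_cancel_left, h]
      linear_combination ih

variable (q) in
/-- The inverse of `(q; q^2)_n`. -/
noncomputable def invOddQPoch (n : ℕ) : A := ∏ i ∈ range n, invOneSubQPow q (2 * i + 1)

lemma baileyPair_double_pentagonal (hq : ∀ k : ℕ, 0 < k → IsUnit (1 - q ^ k)) (n : ℕ) :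
    ∀ N, n ≤ N → invQPoch q n * invOddQPoch q n = baileyKernel q n 0 + ∑ r ∈ Icc 1 N,
      (-1) ^ r * (q ^ 2) ^ pentExp r * (1 + (q ^ 2) ^ r) * baileyKernel q n (2 * r) := by
  induction n with
  | zero =>
    intro N _
    rw [sum_eq_zero fun r hr ↦ by
      rw [baileyKernel_of_lt (by have := (mem_Icc.1 hr).1; omega), mul_zero]]
    simp [baileyKernel, invQPoch, invOddQPoch]
  | succ n ih =>
    intro N hN
    have h := sum_double_pentagonal_recurrence hq n N
    rw [← ih N (by omega), baileyKernel_of_lt (show n + 1 < 2 * N + 1 + 1 by omega), mul_zero,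
      mul_zero, mul_zero] at h
    refine ((hq (n + 1) (by omega)).mul (hq (2 * n + 1) (by omega))).mul_right_cancel ?_
    rw [invOddQPoch, prod_range_succ, ← invOddQPoch]
    linear_combination -h + invQPoch q (n + 1) * (1 - q ^ (n + 1)) * invOddQPoch q n *
      invOneSubQPow_mul hq (show 0 < 2 * n + 1 by omega) +
      invOddQPoch q n * invQPoch_succ_mul hq n

lemma invOneSubQPow_sq (k : ℕ) : invOneSubQPow (q ^ 2) k = invOneSubQPow q (2 * k) := by
  rw [invOneSubQPow, invOneSubQPow, pow_mul]

/-- The two Bailey pairs, in bases `q` and `q ^ 2`, give sums that differ by divisor sums. -/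
lemma dvd_sum_sub_sum (hq : ∀ k : ℕ, 0 < k → IsUnit (1 - q ^ k)) (N : ℕ) :
    q ^ (N + 1) ∣
      (∑ n ∈ Icc 1 N, q ^ n * invOneSubQPow q n ^ 2 * (qPoch q n * invOddQPoch q n) -
        ∑ n ∈ Icc 1 N, (q ^ 2) ^ n * invOneSubQPow (q ^ 2) n ^ 2 * qPoch (q ^ 2) n) -
      (∑ n ∈ Icc 1 N, q ^ n * invOneSubQPow q n ^ 2 -
        ∑ n ∈ Icc 1 N, (q ^ 2) ^ n * invOneSubQPow (q ^ 2) n ^ 2) := by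
  have hq2 : ∀ k : ℕ, 0 < k → IsUnit (1 - (q ^ 2) ^ k) := fun k hk ↦ by
    rw [← pow_mul]
    exact hq _ (by omega)
  have h1 := dvd_sum_baileyPair hq two_pos _ (fun n ↦ invQPoch q n * invOddQPoch q n) N
    fun n hn ↦ baileyPair_double_pentagonal hq n N hn
  have h2 := dvd_sum_baileyPair hq2 one_pos _ (fun n ↦ invQPoch (q ^ 2) n) N
    fun n hn ↦ by simpa only [one_mul] using baileyPair_pentagonal hq2 n N hn
  have h3 : q ^ (N + 1) ∣ (q ^ 2) ^ (N + 1) := by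
    rw [← pow_mul]
    exact pow_dvd_pow q (by omega)
  have h4 := h1.sub (h3.trans h2)
  have e1 : ∑ n ∈ Icc 1 N, q ^ n * invOneSubQPow q n ^ 2 * qPoch q n ^ 2 *
        (invQPoch q n * invOddQPoch q n) =
      ∑ n ∈ Icc 1 N, q ^ n * invOneSubQPow q n ^ 2 * (qPoch q n * invOddQPoch q n) :=
    sum_congr rfl fun n _ ↦ by
      linear_combination q ^ n * invOneSubQPow q n ^ 2 * qPoch q n * invOddQPoch q n *
        qPoch_mul_invQPoch hq n
  have e2 : ∑ n ∈ Icc 1 N, (q ^ 2) ^ n * invOneSubQPow (q ^ 2) n ^ 2 * qPoch (q ^ 2) n ^ 2 *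
        invQPoch (q ^ 2) n =
      ∑ n ∈ Icc 1 N, (q ^ 2) ^ n * invOneSubQPow (q ^ 2) n ^ 2 * qPoch (q ^ 2) n :=
    sum_congr rfl fun n _ ↦ by
      linear_combination (q ^ 2) ^ n * invOneSubQPow (q ^ 2) n ^ 2 * qPoch (q ^ 2) n *
        qPoch_mul_invQPoch hq2 n
  rw [e1, e2] at h4
  -- In base q^2 the r-th α-term is indexed by 2r in base q, so the two α-sums become identical and
  -- cancel.
  simp only [one_mul, invOneSubQPow_sq, ← pow_mul] at h4 ⊢
  convert h4 using 1
  ring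

end QSeries

/-! ### Generating functions of partitions by smallest part -/

section GeneratingFunctions

open Finset PowerSeries

section Topology

open scoped PowerSeries.WithPiTopology

variable {R : Type*} [CommRing R] [TopologicalSpace R] [DiscreteTopology R]

lemma genFun_eq_prod (f : ℕ → ℕ → R) (T : Finset ℕ) (hT : 0 ∉ T)
    (hf : ∀ i ∉ T, ∀ c, f i c = 0) :
    Nat.Partition.genFun f =
      ∏ i ∈ T, (1 + ∑' j, f i (j + 1) • (X : R⟦X⟧) ^ (i * (j + 1))) := by
  have hpos : ∀ i ∈ T, i - 1 + 1 = i := fun i hi ↦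
    Nat.sub_add_cancel (Nat.pos_of_ne_zero fun h ↦ hT (h ▸ hi))
  rw [(Nat.Partition.hasProd_genFun f).unique (hasProd_prod_of_ne_finset_one
    (s := T.image (· - 1)) fun b hb ↦ ?_), prod_image fun i hi j hj h ↦ ?_]
  · exact prod_congr rfl fun i hi ↦ by simp only [hpos i hi]
  · rw [← hpos i hi, ← hpos j hj]
    exact congrArg (· + 1) h
  · have : b + 1 ∉ T := fun h ↦ hb (mem_image.2 ⟨b + 1, h, rfl⟩)
    simp [hf _ this]

lemma one_add_tsum_mul_one_sub {i : ℕ} (hi : i ≠ 0) :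
    (1 + ∑' j : ℕ, (1 : R) • (X : R⟦X⟧) ^ (i * (j + 1))) * (1 - X ^ i) = 1 := by
  have h0 : (X ^ i : R⟦X⟧).constantCoeff = 0 := by simp [hi]
  have hs := WithPiTopology.summable_pow_of_constantCoeff_eq_zero h0
  have h := WithPiTopology.tsum_pow_mul_one_sub_of_constantCoeff_eq_zero h0
  rw [hs.tsum_eq_zero_add] at h
  simpa [pow_mul] using h

lemma tsum_natCast_smul_mul_one_sub_sq {s : ℕ} (hs : s ≠ 0) :
    (∑' j : ℕ, ((j + 1 : ℕ) : R) • (X : R⟦X⟧) ^ (s * (j + 1))) * (1 - X ^ s) ^ 2 = X ^ s := by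
  have h1 := one_add_tsum_mul_one_sub (R := R) hs
  have s1 := Nat.Partition.summable_genFun_term' (fun _ _ ↦ (1 : R)) hs
  have s2 := Nat.Partition.summable_genFun_term' (fun _ c ↦ (c : R)) hs
  -- With y = X^s, S = ∑ j y^j and G = ∑ y^j over j ≥ 1, shifting the index gives S = y + y(S + G).
  have h2 : ∑' j : ℕ, ((j + 1 : ℕ) : R) • (X : R⟦X⟧) ^ (s * (j + 1)) =
      X ^ s + X ^ s * (∑' j : ℕ, ((j + 1 : ℕ) : R) • (X : R⟦X⟧) ^ (s * (j + 1)) +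
        ∑' j : ℕ, (1 : R) • (X : R⟦X⟧) ^ (s * (j + 1))) := by
    conv_lhs => rw [s2.tsum_eq_zero_add]
    rw [← s2.tsum_add s1, ← (s2.add s1).tsum_mul_left]
    congr 1
    · simp
    · refine tsum_congr fun j ↦ ?_
      rw [← add_smul, mul_smul_comm, ← pow_add]
      push_cast
      ring_nf
  linear_combination (1 - X ^ s) * h2 + X ^ s * h1

end Topology

variable (R : Type*) [CommRing R]

/-- The generating function of the partitions with smallest part `s` and all other parts in `T`,
weighted by the number of occurrences of `s`. -/
noncomputable def smallestPartGenFun (T : Finset ℕ) (s : ℕ) : R⟦X⟧ :=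
  PowerSeries.mk fun n ↦ ∑ p : n.Partition,
    if s ∈ p.parts ∧ ∀ i ∈ p.parts, i ∈ insert s T then (p.parts.count s : R) else 0

/-- `genFun` multiplies only over parts that occur, so multiplicity zero of s gets weight 1 rather
than 0; the subtracted series removes these partitions. -/
lemma smallestPartGenFun_eq_sub {T : Finset ℕ} {s : ℕ} (hs : s ∉ T) :
    smallestPartGenFun R T s =
      Nat.Partition.genFun (fun i c ↦ if i = s then (c : R) else if i ∈ T then 1 else 0) -
      Nat.Partition.genFun (fun i _ ↦ if i ∈ T then (1 : R) else 0) := by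
  ext n
  rw [map_sub, Nat.Partition.coeff_genFun, Nat.Partition.coeff_genFun, smallestPartGenFun,
    coeff_mk, ← sum_sub_distrib]
  refine sum_congr rfl fun p _ ↦ ?_
  have key (S : Finset ℕ) : ∏ i ∈ S, (if i ∈ T then (1 : R) else 0) =
      if ∀ i ∈ S, i ∈ T then 1 else 0 := prod_boole
  simp only [Finsupp.prod, Multiset.toFinsupp_support, Multiset.toFinsupp_apply, key,
    Multiset.mem_toFinset]
  by_cases hsp : s ∈ p.parts
  · have h1 : ¬ ∀ i ∈ p.parts, i ∈ T := fun h ↦ hs (h s hsp)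
    rw [if_neg h1, sub_zero, ← mul_prod_erase _ _ (Multiset.mem_toFinset.2 hsp), if_pos rfl,
      prod_congr rfl fun i hi ↦ if_neg (ne_of_mem_erase hi), key, mul_ite, mul_one, mul_zero]
    refine if_congr ?_ rfl rfl
    simp only [hsp, true_and, mem_erase, Multiset.mem_toFinset, mem_insert]
    exact forall_congr' fun i ↦ by tauto
  · rw [if_neg fun h ↦ hsp h.1, prod_congr rfl fun i hi ↦ if_neg fun h ↦ ?_, key]
    · simp
    · exact hsp (h ▸ Multiset.mem_toFinset.1 hi)

open scoped PowerSeries.WithPiTopology in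
lemma smallestPartGenFun_mul {T : Finset ℕ} {s : ℕ} (hT : 0 ∉ T) (hs : s ∉ T) (hs0 : s ≠ 0) :
    smallestPartGenFun R T s * (∏ i ∈ T, (1 - X ^ i)) * (1 - X ^ s) ^ 2 = X ^ s := by
  let _ : TopologicalSpace R := ⊥
  have _ : DiscreteTopology R := ⟨rfl⟩
  rw [smallestPartGenFun_eq_sub R hs, genFun_eq_prod _ (insert s T)
    (by simp [hT, Ne.symm hs0]), genFun_eq_prod _ T hT (by simp +contextual), prod_insert hs]
  · have h1 : ∏ i ∈ T, (1 + ∑' j : ℕ,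
        (if i = s then ((j + 1 : ℕ) : R) else if i ∈ T then 1 else 0) • (X : R⟦X⟧) ^ (i * (j + 1))) =
        ∏ i ∈ T, (1 + ∑' j : ℕ, (1 : R) • (X : R⟦X⟧) ^ (i * (j + 1))) :=
      prod_congr rfl fun i hi ↦ by simp only [if_neg (ne_of_mem_of_not_mem hi hs), if_pos hi]
    have h2 : ∏ i ∈ T, (1 + ∑' j : ℕ,
        (if i ∈ T then (1 : R) else 0) • (X : R⟦X⟧) ^ (i * (j + 1))) =
        ∏ i ∈ T, (1 + ∑' j : ℕ, (1 : R) • (X : R⟦X⟧) ^ (i * (j + 1))) :=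
      prod_congr rfl fun i hi ↦ by simp only [if_pos hi]
    have h3 : (∏ i ∈ T, (1 + ∑' j : ℕ, (1 : R) • (X : R⟦X⟧) ^ (i * (j + 1)))) *
        ∏ i ∈ T, (1 - X ^ i) = 1 := by
      rw [← prod_mul_distrib]
      exact prod_eq_one fun i hi ↦ one_add_tsum_mul_one_sub fun h ↦ hT (h ▸ hi)
    simp only [if_true]
    rw [h1, h2]
    linear_combination tsum_natCast_smul_mul_one_sub_sq (R := R) hs0 + (1 - X ^ s) ^ 2 *
      (∑' j : ℕ, ((j + 1 : ℕ) : R) • (X : R⟦X⟧) ^ (s * (j + 1))) * h3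
  · intro i hi c
    rw [mem_insert, not_or] at hi
    rw [if_neg hi.1, if_neg hi.2]

lemma smallestPart_eq_iff {n : ℕ} (p : n.Partition) {s : ℕ} (hs : s ∈ p.parts) :
    smallestPart p = s ↔ ∀ i ∈ p.parts, s ≤ i := by
  have hmem : smallestPart p ∈ p.parts := Nat.sInf_mem (s := {i | i ∈ p.parts}) ⟨s, hs⟩
  have hle : ∀ i ∈ p.parts, smallestPart p ≤ i := fun i hi ↦
    Nat.sInf_le (s := {i | i ∈ p.parts}) hi
  exact ⟨fun h ↦ h ▸ hle, fun h ↦ (hle s hs).antisymm (h _ hmem)⟩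

open Classical in
/-- Splitting a weighted count of partitions according to the smallest part. -/
lemma sum_smallestPartCount_eq_sum_coeff (P : ℕ → ℕ → Prop) (T : ℕ → Finset ℕ) {n N : ℕ}
    (hn : n ≤ N) (hT : ∀ s ∈ Icc 1 N, ∀ i ≤ N, i ∈ T s ↔ s < i ∧ P s i) (hP : ∀ s, P s s) :
    ((∑ p : n.Partition with ∀ i ∈ p.parts, P (smallestPart p) i, smallestPartCount p : ℕ) : R) =
      ∑ s ∈ Icc 1 N, coeff n (smallestPartGenFun R (T s) s) := by
  simp only [smallestPartGenFun, coeff_mk]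
  rw [sum_comm, sum_filter, Nat.cast_sum]
  refine sum_congr rfl fun p _ ↦ ?_
  have key : ∀ s ∈ Icc 1 N, (s ∈ p.parts ∧ ∀ i ∈ p.parts, i ∈ insert s (T s)) ↔
      s ∈ p.parts ∧ s = smallestPart p ∧ ∀ i ∈ p.parts, P s i := fun s hs ↦ by
    refine and_congr_right fun hsp ↦ ?_
    rw [eq_comm, smallestPart_eq_iff p hsp, ← forall₂_and]
    refine forall₂_congr fun i hi ↦ ?_
    rw [mem_insert, hT s hs i ((Nat.Partition.le_of_mem_parts hi).trans hn)]
    constructor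
    · rintro (rfl | h)
      · exact ⟨le_rfl, hP i⟩
      · exact ⟨h.1.le, h.2⟩
    · rintro ⟨h1, h2⟩
      rcases h1.eq_or_lt with h | h
      · exact Or.inl h.symm
      · exact Or.inr ⟨h, h2⟩
  rw [sum_congr rfl fun s hs ↦ if_congr (key s hs) rfl rfl]
  by_cases hp : smallestPart p ∈ p.parts
  · rw [sum_eq_single_of_mem (smallestPart p) (mem_Icc.2 ⟨p.parts_pos hp,
      (Nat.Partition.le_of_mem_parts hp).trans hn⟩) fun s _ h ↦ if_neg fun h' ↦ h h'.2.1]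
    simp [hp, smallestPartCount]
  · rw [sum_eq_zero fun s _ ↦ if_neg fun h : s ∈ p.parts ∧ s = smallestPart p ∧ _ ↦ hp (h.2.1 ▸ h.1)]
    simp [smallestPartCount, Multiset.count_eq_zero_of_notMem hp]

end GeneratingFunctions

/-! ### Finite products and reduction modulo 2 -/

section Parity

open Finset PowerSeries

section Products

variable {A : Type*} [CommRing A] (q : A)

lemma qPoch_eq_mul_prod_Icc {s N : ℕ} (h : s ≤ N) :
    qPoch q N = qPoch q s * ∏ i ∈ Icc (s + 1) N, (1 - q ^ i) := by
  induction N, h using Nat.le_induction with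
  | base => simp
  | succ N h ih => rw [qPoch_succ, ih, prod_Icc_succ_top (by omega), mul_assoc]

lemma qPoch_two_mul (s : ℕ) :
    qPoch q (2 * s) = qPoch (q ^ 2) s * ∏ i ∈ range s, (1 - q ^ (2 * i + 1)) := by
  induction s with
  | zero => simp [qPoch]
  | succ s ih =>
    rw [show 2 * (s + 1) = 2 * s + 1 + 1 by ring, qPoch_succ, qPoch_succ, ih, qPoch_succ,
      prod_range_succ]
    ring

/-- At N = s both sides are (q)_(2s); each further N contributes just the even factor 1 - q^(2N+2),
as odd indices above 2s are excluded. -/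
lemma qPoch_sq_mul_prod_odd {s N : ℕ} (h : s ≤ N) :
    qPoch (q ^ 2) N * ∏ i ∈ range s, (1 - q ^ (2 * i + 1)) =
      (∏ i ∈ Icc (s + 1) (2 * N) with i ≤ 2 * s ∨ Even i, (1 - q ^ i)) * qPoch q s := by
  induction N, h using Nat.le_induction with
  | base =>
    rw [← qPoch_two_mul, filter_true_of_mem fun i hi ↦ Or.inl (mem_Icc.1 hi).2,
      mul_comm (∏ i ∈ Icc _ _, _), ← qPoch_eq_mul_prod_Icc q (by omega)]
  | succ N h ih =>
    rw [prod_filter] at ih ⊢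
    rw [qPoch_succ, show 2 * (N + 1) = 2 * N + 1 + 1 by ring, prod_Icc_succ_top (by omega),
      prod_Icc_succ_top (by omega), if_neg, if_pos]
    · linear_combination (1 - (q ^ 2) ^ (N + 1)) * ih
    · exact Or.inr ⟨N + 1, by ring⟩
    · rw [not_or, Nat.not_even_iff_odd]
      exact ⟨by omega, N, rfl⟩

lemma prod_odd_mul_invOddQPoch {q : A} (hq : ∀ k : ℕ, 0 < k → IsUnit (1 - q ^ k)) (s : ℕ) :
    (∏ i ∈ range s, (1 - q ^ (2 * i + 1))) * invOddQPoch q s = 1 := by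
  rw [invOddQPoch, ← prod_mul_distrib]
  exact prod_eq_one fun i _ ↦ by rw [mul_comm, invOneSubQPow_mul hq (by omega)]

end Products

variable (R : Type*) [CommRing R]

lemma isUnit_one_sub_X_pow (k : ℕ) (hk : 0 < k) : IsUnit (1 - X ^ k : R⟦X⟧) := by
  rw [PowerSeries.isUnit_iff_constantCoeff]
  simp [hk.ne']

lemma isUnit_one_sub_X_sq_pow (k : ℕ) (hk : 0 < k) : IsUnit (1 - (X ^ 2) ^ k : R⟦X⟧) := by
  rw [← pow_mul]
  exact isUnit_one_sub_X_pow R _ (by omega)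

lemma smallestPartGenFun_mul_qPoch_sq {s N : ℕ} (hs : s ∈ Icc 1 N) :
    smallestPartGenFun R ({i ∈ Icc (s + 1) (2 * N) | i ≤ 2 * s ∨ Even i}) s * qPoch (X ^ 2) N =
      X ^ s * invOneSubQPow X s ^ 2 * (qPoch X s * invOddQPoch X s) := by
  have hX := isUnit_one_sub_X_pow R
  have hs0 : 0 < s := (mem_Icc.1 hs).1
  have h1 := smallestPartGenFun_mul R
    (T := {i ∈ Icc (s + 1) (2 * N) | i ≤ 2 * s ∨ Even i}) (by simp) (by simp) hs0.ne'
  have h2 := qPoch_sq_mul_prod_odd (X : R⟦X⟧) (mem_Icc.1 hs).2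
  have h3 := prod_odd_mul_invOddQPoch hX s
  have h4 := invOneSubQPow_mul hX hs0
  generalize smallestPartGenFun R _ s = w at *
  generalize qPoch (X ^ 2 : R⟦X⟧) N = e at *
  generalize invOneSubQPow (X : R⟦X⟧) s = a at *
  generalize ∏ i ∈ range s, (1 - (X : R⟦X⟧) ^ (2 * i + 1)) = o at *
  generalize ∏ i ∈ Icc (s + 1) (2 * N) with i ≤ 2 * s ∨ Even i, (1 - (X : R⟦X⟧) ^ i) = t at *
  generalize qPoch (X : R⟦X⟧) s = p at *
  generalize invOddQPoch (X : R⟦X⟧) s = b at *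
  linear_combination a ^ 2 * p * b * h1 + w * b * h2 - w * e * h3 -
    w * t * p * b * (a * (1 - X ^ s) + 1) * h4

lemma smallestPartGenFun_mul_qPoch {s N : ℕ} (hs : s ∈ Icc 1 N) :
    smallestPartGenFun R (Icc (s + 1) N) s * qPoch X N * (1 - X ^ s) ^ 2 =
      X ^ s * qPoch X s := by
  have h1 := smallestPartGenFun_mul R (T := Icc (s + 1) N) (by simp) (by simp)
    (Nat.pos_iff_ne_zero.1 (mem_Icc.1 hs).1)
  rw [qPoch_eq_mul_prod_Icc _ (mem_Icc.1 hs).2]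
  linear_combination qPoch X s * h1

lemma expand_two_qPoch (n : ℕ) :
    expand 2 two_ne_zero (qPoch (X : R⟦X⟧) n) = qPoch (X ^ 2) n := by
  simp [qPoch, map_prod, ← pow_mul]

lemma expand_two_smallestPartGenFun_mul_qPoch {s N : ℕ} (hs : s ∈ Icc 1 N) :
    expand 2 two_ne_zero (smallestPartGenFun R (Icc (s + 1) N) s) * qPoch (X ^ 2) N =
      (X ^ 2) ^ s * invOneSubQPow (X ^ 2) s ^ 2 * qPoch (X ^ 2) s := by
  have h1 := congrArg (expand 2 two_ne_zero) (smallestPartGenFun_mul_qPoch R hs)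
  simp only [map_mul, map_pow, map_sub, map_one, expand_two_qPoch, expand_X] at h1
  have h2 := invOneSubQPow_mul (isUnit_one_sub_X_sq_pow R) (mem_Icc.1 hs).1
  linear_combination invOneSubQPow (X ^ 2) s ^ 2 * h1 -
    expand 2 two_ne_zero (smallestPartGenFun R (Icc (s + 1) N) s) * qPoch (X ^ 2) N *
      (invOneSubQPow (X ^ 2) s * (1 - (X ^ 2) ^ s) + 1) * h2

/-- Frobenius in characteristic 2; it shows that the inverse square is a series in X^2. -/
lemma invOneSubQPow_X_sq_eq_expand {k : ℕ} (hk : 0 < k) :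
    invOneSubQPow (X : (ZMod 2)⟦X⟧) k ^ 2 = expand 2 two_ne_zero (invOneSubQPow X k) := by
  have h1 := invOneSubQPow_mul (isUnit_one_sub_X_pow (ZMod 2)) hk
  have h2 := congrArg (expand 2 two_ne_zero) h1
  simp only [map_mul, map_pow, map_sub, map_one, expand_X] at h2
  have h3 : (1 - (X ^ 2) ^ k : (ZMod 2)⟦X⟧) = (1 - X ^ k) ^ 2 := by
    have : (2 : (ZMod 2)⟦X⟧) = 0 := by
      have : (2 : ZMod 2) = 0 := rfl
      rw [← map_ofNat (C (R := ZMod 2)) 2, this, map_zero]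
    linear_combination (X ^ k - X ^ (k * 2)) * this
  rw [h3] at h2
  linear_combination expand 2 two_ne_zero (invOneSubQPow X k) *
    (invOneSubQPow X k * (1 - X ^ k) + 1) * h1 - invOneSubQPow X k ^ 2 * h2

lemma coeff_expand_mul_X_pow_of_odd (f : R⟦X⟧) {k : ℕ} (hk : Odd k) (n : ℕ) :
    coeff (2 * n) (expand 2 two_ne_zero f * X ^ k) = 0 := by
  rw [coeff_mul_X_pow']
  split_ifs with h
  · refine coeff_expand_of_not_dvd 2 two_ne_zero _ ?_
    obtain ⟨j, rfl⟩ := hk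
    omega
  · rfl

lemma coeff_mul_X_pow_of_lt (f : R⟦X⟧) {k m : ℕ} (h : m < k) : coeff m (f * X ^ k) = 0 := by
  rw [coeff_mul_X_pow', if_neg h.not_ge]

lemma coeff_expand_mul_divisorSums (f : (ZMod 2)⟦X⟧) (n : ℕ) :
    coeff (2 * n) (expand 2 two_ne_zero f *
      (∑ k ∈ Icc 1 (2 * n), X ^ k * invOneSubQPow X k ^ 2 -
        ∑ k ∈ Icc 1 (2 * n), (X ^ 2) ^ k * invOneSubQPow (X ^ 2) k ^ 2)) = 0 := by
  set c : ℕ → ZMod 2 := fun k ↦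
    coeff (2 * n) (expand 2 two_ne_zero f * (X ^ k * invOneSubQPow X k ^ 2)) with hc
  have hodd : ∀ k, Odd k → c k = 0 := fun k hk ↦ by
    simp only [hc]
    rw [invOneSubQPow_X_sq_eq_expand hk.pos, mul_comm (X ^ k), ← mul_assoc, ← map_mul]
    exact coeff_expand_mul_X_pow_of_odd _ _ hk n
  have hlarge : ∀ k, 2 * n < k → c k = 0 := fun k hk ↦ by
    simp only [hc]
    rw [mul_comm (X ^ k), ← mul_assoc]
    exact coeff_mul_X_pow_of_lt _ _ hk
  simp only [invOneSubQPow_sq, ← pow_mul]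
  rw [mul_sub, mul_sum, mul_sum, map_sub, map_sum, map_sum, sub_eq_zero]
  change ∑ k ∈ Icc 1 (2 * n), c k = ∑ k ∈ Icc 1 (2 * n), c (2 * k)
  -- Both sums reduce to even indices up to 2n: odd k contribute only odd exponents, and indices
  -- above 2n exceed the degree.
  rw [← sum_subset (Icc_subset_Icc_right (show n ≤ 2 * n by omega)) fun k _ hk ↦
    hlarge (2 * k) (by simp only [mem_Icc] at *; omega),
    ← sum_image (g := (2 * ·)) (s := Icc 1 n) (f := c) fun a _ b _ h ↦ by simpa using h]
  refine (sum_subset (fun k hk ↦ ?_) fun k hk hk' ↦ hodd k ?_).symm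
  · obtain ⟨j, hj, rfl⟩ := mem_image.1 hk
    simp only [mem_Icc] at *
    omega
  · by_contra h
    obtain ⟨j, rfl⟩ := even_iff_two_dvd.1 (Nat.not_odd_iff_even.1 h)
    refine hk' (mem_image.2 ⟨j, ?_, rfl⟩)
    simp only [mem_Icc] at *
    omega

lemma sptOPlus_cast {n N : ℕ} (hn : n ≤ N) :
    (sptOPlus n : R) = ∑ s ∈ Icc 1 N, coeff n (smallestPartGenFun R
      ({i ∈ Icc (s + 1) (2 * N) | i ≤ 2 * s ∨ Even i}) s) := by
  rw [← sum_smallestPartCount_eq_sum_coeff R (fun s i ↦ i ≤ 2 * s ∨ Even i) _ hn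
    (fun s _ i hi ↦ ?_) (fun s ↦ Or.inl (by omega)), sptOPlus]
  · have key (p : n.Partition) : NoLargeOddParts p ↔
        ∀ i ∈ p.parts, i ≤ 2 * smallestPart p ∨ Even i := forall₂_congr fun i _ ↦ by
      rw [← Nat.not_odd_iff_even]
      by_cases h : Odd i <;> simp [h]
    simp only [key]
    congr!
  · simp only [mem_filter, mem_Icc]
    constructor
    · rintro ⟨h1, h2⟩
      exact ⟨h1.1, h2⟩
    · rintro ⟨h1, h2⟩
      exact ⟨⟨h1, by omega⟩, h2⟩

lemma spt_cast {n N : ℕ} (hn : n ≤ N) :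
    (spt n : R) = ∑ s ∈ Icc 1 N, coeff n (smallestPartGenFun R (Icc (s + 1) N) s) := by
  rw [← sum_smallestPartCount_eq_sum_coeff R (fun _ _ ↦ True) _ hn
    (fun s _ i hi ↦ ?_) (fun s ↦ trivial), spt]
  · simp
  · simp only [mem_Icc, and_true]
    omega

/-- The congruence of `sptOPlus (2 * n)` and `spt n`, as an equation in `ZMod 2`. -/
lemma sptOPlus_two_mul_cast (n : ℕ) : (sptOPlus (2 * n) : ZMod 2) = spt n := by
  rw [sptOPlus_cast (ZMod 2) le_rfl, spt_cast (ZMod 2) (show n ≤ 2 * n by omega), ← map_sum,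
    ← map_sum, ← sub_eq_zero, ← coeff_expand_mul 2 two_ne_zero (m := n), ← map_sub]
  set a := ∑ s ∈ Icc 1 (2 * n), smallestPartGenFun (ZMod 2)
    ({i ∈ Icc (s + 1) (2 * (2 * n)) | i ≤ 2 * s ∨ Even i}) s with ha
  set b := ∑ s ∈ Icc 1 (2 * n), smallestPartGenFun (ZMod 2) (Icc (s + 1) (2 * n)) s with hb
  obtain ⟨r, hr⟩ := dvd_sum_sub_sum (isUnit_one_sub_X_pow (ZMod 2)) (2 * n)
  have h1 := coeff_expand_mul_divisorSums (invQPoch X (2 * n)) n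
  have h2 := congrArg (expand 2 two_ne_zero)
    (qPoch_mul_invQPoch (isUnit_one_sub_X_pow (ZMod 2)) (2 * n))
  rw [map_mul, map_one, expand_two_qPoch] at h2
  rw [← sum_congr rfl fun s hs ↦ smallestPartGenFun_mul_qPoch_sq (ZMod 2) hs,
    ← sum_congr rfl fun s hs ↦ expand_two_smallestPartGenFun_mul_qPoch (ZMod 2) hs,
    ← sum_mul, ← sum_mul, ← map_sum, ← ha, ← hb] at hr
  -- The truncation error is a multiple of X^(2n+1), invisible at degree 2n.
  have h3 := coeff_mul_X_pow_of_lt (ZMod 2)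
    (expand 2 two_ne_zero (invQPoch X (2 * n)) * r) (Nat.lt_add_one (2 * n))
  have h4 : a - expand 2 two_ne_zero b = expand 2 two_ne_zero (invQPoch X (2 * n)) *
      (∑ k ∈ Icc 1 (2 * n), X ^ k * invOneSubQPow X k ^ 2 -
        ∑ k ∈ Icc 1 (2 * n), (X ^ 2) ^ k * invOneSubQPow (X ^ 2) k ^ 2) +
      expand 2 two_ne_zero (invQPoch X (2 * n)) * r * X ^ (2 * n + 1) := by
    linear_combination expand 2 two_ne_zero (invQPoch X (2 * n)) * hr -
      (a - expand 2 two_ne_zero b) * h2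
  rw [h4, map_add, h1, h3, add_zero]

end Parity

theorem theorem3 (n : ℕ) : sptOPlus (2 * n) ≡ spt n [MOD 2] := by
  rw [← ZMod.natCast_eq_natCast_iff]
  exact sptOPlus_two_mul_cast n
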